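/- **Theorem 6 (Liveness).** Consider any execution of the leader-follower replication protocol LLFT: asynchronous replicas that may crash at any time, with unreliable time-out based fault detectors, communicating by multicast messages that may be lost, delayed, duplicated or reordered. Replicas form process groups. At each time a running, admitted replica of a group is in one *primary view*, which has a *primary view number* and a single primary replica. The primary admits and removes backups, performs the operations of the application, and sends the backups the order in which it performed them. A backup that suspects the primary of its view with number $i$ may propose itself as the new primary; when the members of the new membership that it proposes have acknowledged this, and it has recovered the state of the old primary known to the remote groups, it begins a new view with number $i+1$, of which it is the primary. Let $V_k, V_{k+1}, V_{k+2}, \dots$ be an infinite sequence of consecutive primary views of a group: each $V_i$ comes into being in the execution, $V_i$ has primary view number $i$, and the primary of $V_{i+1}$ was in view $V_i$ until it began $V_{i+1}$. The *operations in* $V_i$ are the computation operations and the communication operations (carrying out a step of the application, transmitting messages, receiving a message) that the primary of $V_i$ performs as the primary in $V_i$ before $V_{i+1}$ begins. Then the sequence of operations in $V_k, V_{k+1}, \dots$, that is, the concatenation, in the order of the primary view numbers, of the sequences of operations in the single views, is an infinite sequence. In particular, each infinite sequence of consecutive primary views of a group contains at least one infinite sequence of operations. -/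

import Mathlib

/-!
A model of the leader-follower replication protocol LLFT as a labelled transition system:
asynchronous processes that may crash at any time, timers that may expire at any time, and a
multicast network that may lose, delay, duplicate and reorder messages.  Where the protocol leaves
a choice to timing, message loss or buffering policy, the model leaves it open, so that it has
every behaviour of the protocol.  Ranks (the position in the membership list) and timestamps only
influence time-outs and buffer space and have no other effect.
-/

namespace LLFT

/-- The two ways of following the primary: backups redo the operations, or copy the states. -/
inductive ReplicationType
  | semiActive
  | semiPassive

/-- The static data of a system: process groups, virtual connections between two groups, and the
replicated application.  An `AppCall` is a (system or library) call together with the thread that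
makes it and with the result it returns, so `exec` and `out` are functions although the
application is not deterministic. -/
structure System where
  Group : Type
  Conn : Type
  client : Conn → Group
  server : Conn → Group
  replication : Group → ReplicationType
  Payload : Type
  AppState : Type
  AppCall : Type
  /-- initial application state -/
  appInit : Group → AppState
  /-- the calls, with their possible results, that can be made in a state -/
  enabled : AppState → AppCall → Prop
  /-- the state after a call -/
  exec : AppState → AppCall → AppState
  /-- the message, if any, that a call originates, and the end of a connection (`true` for the
  client end) on which it is sent -/
  out : AppState → AppCall → Option ((Conn × Bool) × Payload)
  /-- the state after delivery of a message at an end of a connection -/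
  deliver : AppState → Conn × Bool → Payload → AppState
  /-- number of retransmissions before a silent replica is given up -/
  maxCount : ℕ

/-- Identity of a replica: host, process id, start-up time.  A process that recovers, or that
resets its state and rejoins the group, is a new replica with a new identity. -/
abbrev BirthId := ℕ × ℕ × ℕ

/-- An end of a connection. -/
abbrev System.End (S : System) := S.Conn × Bool

/-- The group at an end of a connection. -/
def System.endGroup (S : System) (e : S.End) : S.Group :=
  if e.2 then S.client e.1 else S.server e.1

/-- The opposite end of a connection. -/
def System.peer (S : System) (e : S.End) : S.End := (e.1, !e.2)

/-- A primary view: the group, the primary view number, the primary replica, and the precedence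
of the primary. -/
structure PrimaryView (S : System) where
  group : S.Group
  pvn : ℕ
  primary : BirthId
  prec : ℕ

/-- A member of a group with its precedence.  A membership is a list of members in the order of
precedence; the rank of a member is its position in that list. -/
structure Member where
  id : BirthId
  prec : ℕ

/-- The identities of the members in a membership. -/
def ids (ms : List Member) : List BirthId := ms.map Member.id

/-- The largest precedence in a membership. -/
def maxPrec (ms : List Member) : ℕ := (ms.map Member.prec).foldr max 0

/-- What an ordering information entry orders: a call with its result, the delivery at an end of a
connection of the message with given view number and sequence number, or the start of a view. -/
inductive OrderKind (S : System)
  | call (c : S.AppCall)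
  | deliver (e : S.End) (pvn msn : ℕ)
  | viewChange

/-- An ordering information entry: the view whose primary made it (for a `viewChange` the new
view), its number in the sequence of entries, what it orders, and the state that results (which
only semi-passive replication uses). -/
structure OrderInfo (S : System) where
  view : PrimaryView S
  seq : ℕ
  kind : OrderKind S
  upd : S.AppState

/-- A message on a connection: a `Request` or `Reply` if it has a payload, a `KeepAlive`
otherwise.  `src` is the end at which it is sent.  `so` is ordering information of the sending
group and `ro` is ordering information of the receiving group that is reflected back. -/
structure AppMsg (S : System) where
  src : S.End
  pvn : ℕ
  prec : ℕ
  msn : ℕ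
  ack : ℕ
  payload : Option S.Payload
  so : List (OrderInfo S)
  ro : List (OrderInfo S)

/-- The state that is transferred to a new backup. -/
structure Checkpoint (S : System) where
  app : S.AppState
  log : List (OrderInfo S)
  sentCount : S.End → ℕ
  expPvn : S.End → ℕ
  recvMsn : S.End → ℕ
  queue : S.End → List (AppMsg S)
  remoteInfo : S.End → Set (OrderInfo S)

/-- Control messages that carry no ordering information. -/
inductive Control (S : System)
  | firstAck (e : S.End) (ack : ℕ)
  | secondAck (e : S.End) (ack : ℕ)
  | nack (e : S.End) (msn : ℕ)
  | heartbeat (g : S.Group)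

/-- The messages of the Messaging and the Membership Protocol. -/
inductive Msg (S : System)
  | proposeBackup (g : S.Group) (b : BirthId)
  | acceptBackup (v : PrimaryView S) (ms : List Member) (newcomer : Member)
  | removeBackup (v : PrimaryView S) (ms : List Member)
  | ackMembership (v : PrimaryView S) (ms : List Member) (acker : BirthId)
  | state (v : PrimaryView S) (dest : BirthId) (cp : Checkpoint S)
  | proposePrimary (g : S.Group) (ms : List Member) (pvn : ℕ) (proposer : Member)
  | ackProposePrimary (g : S.Group) (pvn : ℕ) (proposer acker : BirthId)
  | newPrimaryView (e : S.End) (pvn prec : ℕ) (info : List (OrderInfo S))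
  | ackNewPrimaryView (e : S.End) (pvn recvUpTo lastSent : ℕ)
  | orderInfo (v : PrimaryView S) (info : List (OrderInfo S))
  | app (m : AppMsg S)
  | control (sender : BirthId) (c : Control S)

/-- The message by which the primary announces a membership: of an addition or of a removal. -/
def membershipMsg {S : System} (v : PrimaryView S) (ms : List Member) : Option Member → Msg S
  | some n => .acceptBackup v ms n
  | none => .removeBackup v ms

/-- The role that a replica currently plays. -/
inductive Phase
  /-- has asked to be admitted to the group -/
  | joining
  /-- is admitted and waits for the `State` message -/
  | awaitingState
  | backup
  /-- a backup that has appointed itself as the new primary (first phase of a primary change) -/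
  | proposing
  /-- a new primary that recovers the state of the old primary (second phase) -/
  | recovering
  | primary

/-- The local state of a replica. -/
structure Local (S : System) where
  group : S.Group
  phase : Phase
  /-- current primary view -/
  view : Option (PrimaryView S)
  members : List Member
  /-- own precedence -/
  prec : ℕ
  /-- precedence of the primary, or of the best proposed new primary -/
  primaryPrec : ℕ
  /-- largest precedence assigned so far -/
  lastPrec : ℕ
  /-- view number and precedence in the `ProposePrimary` messages received -/
  proposals : List (ℕ × ℕ)
  /-- proposed new primaries that were acknowledged -/
  accepted : List BirthId
  /-- messages that are under the retransmission timer -/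
  pending : Set (Msg S)
  retries : ℕ
  /-- members that acknowledged the proposal or membership change under way -/
  acks : Finset BirthId
  /-- the backup that the membership change under way adds, if it adds one -/
  adding : Option Member
  /-- new backups that have not yet been sent a `State` message -/
  newcomers : List BirthId
  /-- in recovery, for each connection: what the remote group has received and has sent -/
  need : S.End → Option (ℕ × ℕ)
  app : S.AppState
  /-- ordering information made (at the primary) or carried out (at a backup) -/
  log : List (OrderInfo S)
  /-- ordering information received -/
  pool : Set (OrderInfo S)
  /-- ordering information of the remote groups, to be reflected back -/
  remoteInfo : S.End → Set (OrderInfo S)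
  /-- sequence number of the last message sent -/
  sentCount : S.End → ℕ
  /-- messages originated, kept for retransmission -/
  sent : Set (AppMsg S)
  /-- view number of the remote primary -/
  expPvn : S.End → ℕ
  /-- sequence number of the last message received without a gap -/
  recvMsn : S.End → ℕ
  /-- messages received without a gap and not yet delivered -/
  queue : S.End → List (AppMsg S)

/-- Local state of a process that has just begun to join the group `g`. -/
def Local.fresh {S : System} (g : S.Group) (b : BirthId) : Local S where
  group := g
  phase := .joining
  view := none
  members := []
  prec := 0
  primaryPrec := 0
  lastPrec := 0
  proposals := []
  accepted := []
  pending := {.proposeBackup g b}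
  retries := 0
  acks := ∅
  adding := none
  newcomers := []
  need := fun _ => none
  app := S.appInit g
  log := []
  pool := ∅
  remoteInfo := fun _ => ∅
  sentCount := fun _ => 0
  sent := ∅
  expPvn := fun _ => 0
  recvMsn := fun _ => 0
  queue := fun _ => []

/-- The checkpoint of a local state. -/
def Local.checkpoint {S : System} (l : Local S) : Checkpoint S where
  app := l.app
  log := l.log
  sentCount := l.sentCount
  expPvn := l.expPvn
  recvMsn := l.recvMsn
  queue := l.queue
  remoteInfo := l.remoteInfo

/-- A replica has not started, runs, or has stopped: it crashed, or reset its state (to rejoin the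
group under a new identity). -/
inductive Status (S : System)
  | notStarted
  | running (l : Local S)
  | stopped

/-- The observable part of a step of a replica: the application-level computation it carries out,
the message it receives, and the messages it transmits. -/
structure Action (S : System) where
  comp : Option (OrderKind S)
  recv : Option (Msg S)
  sent : Set (Msg S)

/-- Operations are computation operations and communication operations. -/
def Action.IsOperation {S : System} (a : Action S) : Prop :=
  a.comp.isSome ∨ a.recv.isSome ∨ a.sent.Nonempty

open scoped Classical in
/-- `f` with the value at `e` replaced by `x`. -/
noncomputable def setAt {α β : Type} (f : α → β) (e : α) (x : β) : α → β :=
  fun e' => if e' = e then x else f e'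

/-- All members other than `b` have acknowledged. -/
def AllAcked (b : BirthId) (ms : List Member) (acks : Finset BirthId) : Prop :=
  ∀ q ∈ ms, q.id ≠ b → q.id ∈ acks

/-- The members that are left when `b` excludes those that have not acknowledged. -/
def dropSilent (b : BirthId) (ms : List Member) (acks : Finset BirthId) : List Member :=
  ms.filter fun q => decide (q.id = b ∨ q.id ∈ acks)

/-- The next ordering information entry in view `v`. -/
def Local.entry {S : System} (l : Local S) (v : PrimaryView S) (k : OrderKind S)
    (s : S.AppState) : OrderInfo S :=
  ⟨v, l.log.length, k, s⟩

/-- A message in view `v` with sequence number `n`, sent at the end `e`. -/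
def Local.mkMsg {S : System} (l : Local S) (v : PrimaryView S) (e : S.End) (n : ℕ)
    (p : Option S.Payload) (so ro : List (OrderInfo S)) : AppMsg S :=
  ⟨e, v.pvn, v.prec, n, l.recvMsn e, p, so, ro⟩

/-- The state after a call is carried out and its ordering information entry `x` is logged;
`ms` is what is added to the messages kept for retransmission. -/
noncomputable def Local.afterCall {S : System} (l : Local S) (c : S.AppCall) (x : OrderInfo S)
    (ms : Set (AppMsg S)) : Local S :=
  { l with
    app := x.upd
    log := l.log ++ [x]
    sentCount := match S.out l.app c with
      | none => l.sentCount
      | some (e, _) => setAt l.sentCount e (l.sentCount e + 1)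
    sent := l.sent ∪ ms }

/-- The state after the first message in the queue at `e` is delivered and the ordering
information entry `x` is logged. -/
noncomputable def Local.afterDeliver {S : System} (l : Local S) (e : S.End)
    (x : OrderInfo S) : Local S :=
  { l with
    app := x.upd
    log := l.log ++ [x]
    queue := setAt l.queue e (l.queue e).tail }

/-- What a backup does with an entry that orders an operation with result `s`: under semi-active
replication it obtains the state by performing the operation, under semi-passive replication it
performs no operation and copies the state. -/
def resultOf {S : System} (g : S.Group) (x : OrderInfo S) (s : S.AppState) :
    S.AppState × Option (OrderKind S) :=
  match S.replication g with
  | .semiActive => (s, some x.kind)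
  | .semiPassive => (x.upd, none)

/-- The ordering information that is piggybacked on a message `m`, received at the end `e`. -/
noncomputable def Local.addInfo {S : System} (l : Local S) (e : S.End) (m : AppMsg S) : Local S :=
  { l with
    pool := l.pool ∪ {x | x ∈ m.ro}
    remoteInfo := setAt l.remoteInfo e (l.remoteInfo e ∪ {x | x ∈ m.so}) }

/-- The replica is active in the group: it has been admitted and has its state. -/
def Local.Active {S : System} (l : Local S) : Prop :=
  l.phase = .backup ∨ l.phase = .proposing ∨ l.phase = .recovering ∨ l.phase = .primary

/-- Which control messages a replica can send. -/
def Local.ControlOk {S : System} (l : Local S) : Control S → Prop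
  | .firstAck e r => S.endGroup e = l.group ∧ l.phase = .primary ∧ r = l.recvMsn e
  | .secondAck e _ => S.endGroup e = l.group
  | .nack e n => S.endGroup e = l.group ∧ n = l.recvMsn e + 1
  | .heartbeat g => g = l.group

/-- The groups to which a control message is addressed. -/
def Control.To {S : System} (g : S.Group) : Control S → Prop
  | .firstAck e _ | .secondAck e _ => g = S.endGroup (S.peer e)
  | .nack e _ => g = S.endGroup (S.peer e) ∨ g = S.endGroup e
  | .heartbeat h => g = h

/-- `Step S b s a s'`: the replica `b` can go from `s` to `s'` with the action `a`. -/
inductive Step (S : System) (b : BirthId) : Status S → Action S → Status S → Prop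
  /- Faults. -/
  | crash (l : Local S) : Step S b (.running l) ⟨none, none, ∅⟩ .stopped
  -- Joining a group.
  | start (g : S.Group) :
      Step S b .notStarted ⟨none, none, {.proposeBackup g b}⟩ (.running (Local.fresh g b))
  /- Expiration of a retransmission timer. -/
  | retransmit (l : Local S) (hp : l.pending.Nonempty)
      (hr : l.phase = .recovering ∨ l.retries ≤ S.maxCount) :
      Step S b (.running l) ⟨none, none, l.pending⟩
        (.running { l with retries := l.retries + 1 })
  /- Nobody has answered: become the first member and the primary; `k` are the current view
  numbers of the remote groups. -/
  | becomeFirst (l : Local S) (k : S.End → ℕ) (hph : l.phase = .joining)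
      (hr : S.maxCount < l.retries) :
      Step S b (.running l) ⟨none, none, ∅⟩
        (.running { l with
          phase := .primary, view := some ⟨l.group, 0, b, 1⟩, members := [⟨b, 1⟩]
          prec := 1, primaryPrec := 1, lastPrec := 1, pending := ∅, retries := 0, expPvn := k })
  /- The joining replica receives an `AcceptBackup` message. -/
  | recvAccept (l : Local S) (v : PrimaryView S) (ms : List Member) (n : Member)
      (hph : l.phase = .joining) (hg : v.group = l.group) (hb : n.id = b) (hn : n ∈ ms) :
      Step S b (.running l)
        ⟨none, some (.acceptBackup v ms n), {.ackMembership v ms b}⟩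
        (.running { l with
          phase := .awaitingState, view := some v, members := ms, prec := n.prec
          primaryPrec := v.prec, lastPrec := maxPrec ms, pending := ∅, retries := 0 })
  /- The new backup receives the `State` message. -/
  | recvState (l : Local S) (v : PrimaryView S) (cp : Checkpoint S)
      (hph : l.phase = .awaitingState) (hv : l.view = some v) :
      Step S b (.running l) ⟨none, some (.state v b cp), ∅⟩
        (.running { l with
          phase := .backup, app := cp.app, log := cp.log, sentCount := cp.sentCount
          expPvn := cp.expPvn, recvMsn := cp.recvMsn, queue := cp.queue
          remoteInfo := cp.remoteInfo })
  -- Addition and removal of backups, at the primary.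
  | addBackup (l : Local S) (v : PrimaryView S) (n : BirthId)
      (hph : l.phase = .primary) (hv : l.view = some v) (hn : n ∉ ids l.members) :
      Step S b (.running l)
        ⟨none, some (.proposeBackup l.group n),
          {.acceptBackup v (l.members ++ [⟨n, l.lastPrec + 1⟩]) ⟨n, l.lastPrec + 1⟩}⟩
        (.running { l with
          members := l.members ++ [⟨n, l.lastPrec + 1⟩], lastPrec := l.lastPrec + 1
          pending := {.acceptBackup v (l.members ++ [⟨n, l.lastPrec + 1⟩]) ⟨n, l.lastPrec + 1⟩}
          retries := 0, acks := ∅, adding := some ⟨n, l.lastPrec + 1⟩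
          newcomers := l.newcomers ++ [n] })
  /- Expiration of the fault detection timer for the backup `q`. -/
  | remove (l : Local S) (v : PrimaryView S) (q : BirthId)
      (hph : l.phase = .primary) (hv : l.view = some v) (hq : q ∈ ids l.members) (hqb : q ≠ b) :
      Step S b (.running l)
        ⟨none, none, {.removeBackup v (l.members.filter fun x => decide (x.id ≠ q))}⟩
        (.running { l with
          members := l.members.filter fun x => decide (x.id ≠ q)
          pending := {.removeBackup v (l.members.filter fun x => decide (x.id ≠ q))}
          retries := 0, acks := ∅, adding := none
          newcomers := l.newcomers.filter fun x => decide (x ≠ q) })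
  /- Too many retransmissions: exclude the members that have not acknowledged. -/
  | excludeSilent (l : Local S) (v : PrimaryView S)
      (hph : l.phase = .primary) (hv : l.view = some v) (hp : l.pending.Nonempty)
      (hr : S.maxCount < l.retries) :
      Step S b (.running l)
        ⟨none, none, {membershipMsg v (dropSilent b l.members l.acks) l.adding}⟩
        (.running { l with
          members := dropSilent b l.members l.acks
          pending := {membershipMsg v (dropSilent b l.members l.acks) l.adding}
          retries := 0
          newcomers := l.newcomers.filter
            fun x => decide (x ∈ ids (dropSilent b l.members l.acks)) })
  | recvMembershipAck (l : Local S) (v : PrimaryView S) (q : BirthId)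
      (hph : l.phase = .primary) (hv : l.view = some v) :
      Step S b (.running l) ⟨none, some (.ackMembership v l.members q), ∅⟩
        (.running { l with acks := insert q l.acks })
  /- All have acknowledged: checkpoint the state and send it to the new backups. -/
  | commit (l : Local S) (v : PrimaryView S)
      (hph : l.phase = .primary) (hv : l.view = some v) (hp : l.pending.Nonempty)
      (ha : AllAcked b l.members l.acks) :
      Step S b (.running l)
        ⟨none, none, {m | ∃ n ∈ l.newcomers, m = .state v n l.checkpoint}⟩
        (.running { l with pending := ∅, newcomers := [], adding := none })
  -- Addition and removal of backups, at an existing backup.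
  | recvMembership (l : Local S) (v : PrimaryView S) (ms : List Member) (n : Option Member)
      (hph : l.phase = .backup ∨ l.phase = .awaitingState) (hv : l.view = some v)
      (hb : b ∈ ids ms) :
      Step S b (.running l)
        ⟨none, some (membershipMsg v ms n), {.ackMembership v ms b}⟩
        (.running { l with members := ms, lastPrec := max l.lastPrec (maxPrec ms) })
  | removed (l : Local S) (v w : PrimaryView S) (ms : List Member) (n : Option Member)
      (hph : l.phase = .backup ∨ l.phase = .awaitingState) (hv : l.view = some v)
      (hg : w.group = l.group) (hp : v.pvn ≤ w.pvn) (hb : b ∉ ids ms) :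
      Step S b (.running l) ⟨none, some (membershipMsg w ms n), ∅⟩ .stopped
  -- Change of the primary, first phase.
  /- Expiration of the fault detection timer for the primary. -/
  | propose (l : Local S) (v : PrimaryView S) (ms : List Member)
      (hph : l.phase = .backup) (hv : l.view = some v)
      (hno : ∀ x ∈ l.proposals, ¬ (v.pvn ≤ x.1 ∧ x.2 < l.prec))
      (hms : ms = l.members.filter fun q => decide (q.id ≠ v.primary ∧ l.prec ≤ q.prec)) :
      Step S b (.running l)
        ⟨none, none, {.proposePrimary l.group ms v.pvn ⟨b, l.prec⟩}⟩
        (.running { l with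
          phase := .proposing, members := ms
          pending := {.proposePrimary l.group ms v.pvn ⟨b, l.prec⟩}
          retries := 0, acks := ∅ })
  | proposeFewer (l : Local S) (v : PrimaryView S)
      (hph : l.phase = .proposing) (hv : l.view = some v) (hr : S.maxCount < l.retries) :
      Step S b (.running l)
        ⟨none, none,
          {.proposePrimary l.group (dropSilent b l.members l.acks) v.pvn ⟨b, l.prec⟩}⟩
        (.running { l with
          members := dropSilent b l.members l.acks
          pending :=
            {.proposePrimary l.group (dropSilent b l.members l.acks) v.pvn ⟨b, l.prec⟩}
          retries := 0 })
  | recvProposalAck (l : Local S) (v : PrimaryView S) (q : BirthId)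
      (hph : l.phase = .proposing) (hv : l.view = some v) :
      Step S b (.running l) ⟨none, some (.ackProposePrimary l.group v.pvn b q), ∅⟩
        (.running { l with acks := insert q l.acks })
  | acceptProposal (l : Local S) (v : PrimaryView S) (ms : List Member) (pvn : ℕ) (p : Member)
      (hph : l.phase = .backup) (hv : l.view = some v) (hp : p.id ≠ b) (hpvn : v.pvn ≤ pvn)
      (hb : b ∈ ids ms) (hprec : l.primaryPrec < p.prec) :
      Step S b (.running l)
        ⟨none, some (.proposePrimary l.group ms pvn p),
          {.ackProposePrimary l.group pvn p.id b}⟩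
        (.running { l with
          primaryPrec := p.prec, members := ms, accepted := p.id :: l.accepted
          proposals := (pvn, p.prec) :: l.proposals })
  | ignoreProposal (l : Local S) (v : PrimaryView S) (ms : List Member) (pvn : ℕ) (p : Member)
      (hph : l.phase = .backup) (hv : l.view = some v) (hp : p.id ≠ b)
      (h : pvn < v.pvn ∨ (b ∈ ids ms ∧ p.prec ≤ l.primaryPrec)) :
      Step S b (.running l) ⟨none, some (.proposePrimary l.group ms pvn p), ∅⟩
        (.running { l with proposals := (pvn, p.prec) :: l.proposals })
  | deposed (l : Local S) (v : PrimaryView S) (ms : List Member) (pvn : ℕ) (p : Member)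
      (hv : l.view = some v) (hp : p.id ≠ b) (hpvn : v.pvn ≤ pvn) (hb : b ∉ ids ms) :
      Step S b (.running l) ⟨none, some (.proposePrimary l.group ms pvn p), ∅⟩ .stopped
  -- Change of the primary, second phase.
  /- All have acknowledged: query the remote group of each connection. -/
  | elected (l : Local S) (v : PrimaryView S) (info : S.End → List (OrderInfo S))
      (hph : l.phase = .proposing) (hv : l.view = some v)
      (ha : AllAcked b l.members l.acks) (hi : ∀ e, ∀ x ∈ info e, x ∈ l.log) :
      Step S b (.running l)
        ⟨none, none, {m | ∃ e, S.endGroup e = l.group ∧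
          m = .newPrimaryView e (v.pvn + 1) l.prec (info e)}⟩
        (.running { l with
          phase := .recovering, primaryPrec := l.prec, need := fun _ => none
          pending := {m | ∃ e, S.endGroup e = l.group ∧
            m = .newPrimaryView e (v.pvn + 1) l.prec (info e)}
          retries := 0 })
  /- At the remote group; `e` is the end there.  Only its primary acknowledges. -/
  | recvNewPrimaryView (l : Local S) (e : S.End) (pvn prec : ℕ) (info : List (OrderInfo S))
      (out : Set (Msg S)) (hact : l.Active) (he : S.endGroup e = l.group)
      (hpvn : l.expPvn e < pvn)
      (hout : (l.phase = .primary ∨ l.phase = .recovering) ∧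
          out = {.ackNewPrimaryView e pvn (l.recvMsn e) (l.sentCount e)} ∨
        (l.phase = .backup ∨ l.phase = .proposing) ∧ out = ∅) :
      Step S b (.running l) ⟨none, some (.newPrimaryView (S.peer e) pvn prec info), out⟩
        (.running { l with
          expPvn := setAt l.expPvn e pvn, recvMsn := setAt l.recvMsn e 0
          remoteInfo := setAt l.remoteInfo e (l.remoteInfo e ∪ {x | x ∈ info}) })
  | recvNewPrimaryViewAck (l : Local S) (v : PrimaryView S) (e : S.End) (r s : ℕ)
      (hph : l.phase = .recovering) (hv : l.view = some v) (he : S.endGroup e = l.group) :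
      Step S b (.running l)
        ⟨none, some (.ackNewPrimaryView (S.peer e) (v.pvn + 1) r s), ∅⟩
        (.running { l with need := setAt l.need e (some (r, s)) })
  /- All messages that the old primary sent are reproduced, all missing messages are received,
  and all operations that are known to be ordered are carried out: the new view begins. -/
  | installView (l : Local S) (v : PrimaryView S)
      (hph : l.phase = .recovering) (hv : l.view = some v)
      (hneed : ∀ e, S.endGroup e = l.group →
        ∃ r s, l.need e = some (r, s) ∧ r ≤ l.sentCount e ∧ s ≤ l.recvMsn e)
      (hpool : ∀ x ∈ l.pool, x.view = v → x.seq < l.log.length) :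
      Step S b (.running l) ⟨none, none, ∅⟩
        (.running { l with
          phase := .primary, view := some ⟨l.group, v.pvn + 1, b, l.prec⟩
          log := l.log ++ [l.entry ⟨l.group, v.pvn + 1, b, l.prec⟩ .viewChange l.app]
          sentCount := fun _ => 0, pending := ∅, retries := 0, acks := ∅
          adding := none, newcomers := [] })
  /- A backup that has carried out all operations ordered before it switches to the new view of a
  primary whose proposal it has acknowledged. -/
  | followView (l : Local S) (v : PrimaryView S) (x : OrderInfo S)
      (hph : l.phase = .backup) (hv : l.view = some v) (hx : x ∈ l.pool)
      (hk : x.kind = .viewChange) (hs : x.seq = l.log.length) (hg : x.view.group = l.group)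
      (hpvn : v.pvn < x.view.pvn) (ha : x.view.primary ∈ l.accepted) :
      Step S b (.running l) ⟨none, none, ∅⟩
        (.running { l with
          view := some x.view, log := l.log ++ [x], sentCount := fun _ => 0 })
  -- The application at the primary.
  | call (l : Local S) (v : PrimaryView S) (c : S.AppCall)
      (hph : l.phase = .primary) (hv : l.view = some v) (hc : S.enabled l.app c)
      (ho : S.out l.app c = none) :
      Step S b (.running l) ⟨some (.call c), none, ∅⟩
        (.running (l.afterCall c (l.entry v (.call c) (S.exec l.app c)) ∅))
  /- A call that originates a message. -/
  | callSend (l : Local S) (v : PrimaryView S) (c : S.AppCall) (e : S.End) (p : S.Payload)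
      (so ro : List (OrderInfo S)) (m : AppMsg S)
      (hph : l.phase = .primary) (hv : l.view = some v) (hc : S.enabled l.app c)
      (ho : S.out l.app c = some (e, p)) (he : S.endGroup e = l.group)
      (hso : ∀ x ∈ so, x ∈ l.log ++ [l.entry v (.call c) (S.exec l.app c)])
      (hro : ∀ x ∈ ro, x ∈ l.remoteInfo e)
      (hm : m = l.mkMsg v e (l.sentCount e + 1) (some p) so ro) :
      Step S b (.running l) ⟨some (.call c), none, {.app m}⟩
        (.running (l.afterCall c (l.entry v (.call c) (S.exec l.app c)) {m}))
  | deliver (l : Local S) (v : PrimaryView S) (e : S.End) (m : AppMsg S)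
      (q : List (AppMsg S)) (p : S.Payload)
      (hph : l.phase = .primary) (hv : l.view = some v)
      (hq : l.queue e = m :: q) (hp : m.payload = some p) :
      Step S b (.running l) ⟨some (.deliver e m.pvn m.msn), none, ∅⟩
        (.running (l.afterDeliver e
          (l.entry v (.deliver e m.pvn m.msn) (S.deliver l.app e p))))
  -- The application at a backup, or at a new primary that recovers.
  | followCall (l : Local S) (v : PrimaryView S) (x : OrderInfo S) (c : S.AppCall)
      (ms : Set (AppMsg S))
      (hph : l.phase = .backup ∨ l.phase = .proposing ∨ l.phase = .recovering)
      (hv : l.view = some v) (hx : x ∈ l.pool) (hk : x.kind = .call c)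
      (hs : x.seq = l.log.length) (hxv : x.view = v)
      (hms : ms = {m | S.replication l.group = .semiActive ∧ ∃ e p,
        S.out l.app c = some (e, p) ∧ m = l.mkMsg v e (l.sentCount e + 1) (some p) [] []}) :
      Step S b (.running l) ⟨(resultOf l.group x (S.exec l.app c)).2, none, ∅⟩
        (.running { l.afterCall c x ms with
          app := (resultOf l.group x (S.exec l.app c)).1 })
  | followDeliver (l : Local S) (v : PrimaryView S) (x : OrderInfo S) (e : S.End)
      (m : AppMsg S) (q : List (AppMsg S)) (p : S.Payload)
      (hph : l.phase = .backup ∨ l.phase = .proposing ∨ l.phase = .recovering)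
      (hv : l.view = some v) (hx : x ∈ l.pool) (hk : x.kind = .deliver e m.pvn m.msn)
      (hs : x.seq = l.log.length) (hxv : x.view = v)
      (hq : l.queue e = m :: q) (hp : m.payload = some p) :
      Step S b (.running l) ⟨(resultOf l.group x (S.deliver l.app e p)).2, none, ∅⟩
        (.running { l.afterDeliver e x with
          app := (resultOf l.group x (S.deliver l.app e p)).1 })
  -- Messaging.
  /- Receipt of a `Request` or `Reply` in sequence.  A message that arrives early is buffered by
  the protocol; here it is received when its turn has come, as a message that was transmitted
  remains receivable. -/
  | recvApp (l : Local S) (e : S.End) (m : AppMsg S)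
      (hact : l.Active) (hm : m.src = S.peer e) (he : S.endGroup e = l.group)
      (hpvn : m.pvn = l.expPvn e) (hp : m.payload.isSome) (hn : m.msn = l.recvMsn e + 1) :
      Step S b (.running l) ⟨none, some (.app m), ∅⟩
        (.running { l.addInfo e m with
          queue := setAt l.queue e (l.queue e ++ [m])
          recvMsn := setAt l.recvMsn e (l.recvMsn e + 1) })
  | recvKeepAlive (l : Local S) (e : S.End) (m : AppMsg S)
      (hact : l.Active) (hm : m.src = S.peer e) (he : S.endGroup e = l.group)
      (hpvn : m.pvn = l.expPvn e) (hp : m.payload = none) :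
      Step S b (.running l) ⟨none, some (.app m), ∅⟩ (.running (l.addInfo e m))
  | sendKeepAlive (l : Local S) (v : PrimaryView S) (e : S.End) (so ro : List (OrderInfo S))
      (hph : l.phase = .primary) (hv : l.view = some v) (he : S.endGroup e = l.group)
      (hso : ∀ x ∈ so, x ∈ l.log) (hro : ∀ x ∈ ro, x ∈ l.remoteInfo e) :
      Step S b (.running l) ⟨none, none, {.app (l.mkMsg v e 0 none so ro)}⟩ (.running l)
  /- A message with a higher precedence than that of the primary reveals a competing membership:
  pass it on in the group, reset the state and rejoin. -/
  | outranked (l : Local S) (m : AppMsg S) (hact : l.Active)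
      (hg : S.endGroup m.src = l.group ∨ S.endGroup (S.peer m.src) = l.group)
      (hp : l.primaryPrec < m.prec) :
      Step S b (.running l) ⟨none, some (.app m), {.app m}⟩ .stopped
  | resend (l : Local S) (m : AppMsg S) (hph : l.phase = .primary) (hm : m ∈ l.sent) :
      Step S b (.running l) ⟨none, none, {.app m}⟩ (.running l)
  /- Multicast of ordering information within the group. -/
  | sendOrder (l : Local S) (v : PrimaryView S) (info : List (OrderInfo S))
      (hph : l.phase = .primary) (hv : l.view = some v) (hi : ∀ x ∈ info, x ∈ l.log) :
      Step S b (.running l) ⟨none, none, {.orderInfo v info}⟩ (.running l)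
  | recvOrder (l : Local S) (v : PrimaryView S) (info : List (OrderInfo S))
      (hact : l.Active) (hg : v.group = l.group) :
      Step S b (.running l) ⟨none, some (.orderInfo v info), ∅⟩
        (.running { l with pool := l.pool ∪ {x | x ∈ info} })
  | sendControl (l : Local S) (c : Control S) (hact : l.Active) (hc : l.ControlOk c) :
      Step S b (.running l) ⟨none, none, {.control b c}⟩ (.running l)
  | recvControl (l : Local S) (q : BirthId) (c : Control S) (hact : l.Active)
      (hc : c.To l.group) :
      Step S b (.running l) ⟨none, some (.control q c), ∅⟩ (.running l)

/-- A global state: the status of every replica, and the messages transmitted so far.  A message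
may be received by any number of replicas, any number of times, in any order, or never. -/
structure Config (S : System) where
  status : BirthId → Status S
  net : Set (Msg S)

/-- An execution: starting with no process and no message, in each step one replica acts. -/
structure Execution (S : System) where
  conf : ℕ → Config S
  actor : ℕ → BirthId
  act : ℕ → Action S
  init_status : ∀ b, (conf 0).status b = .notStarted
  init_net : (conf 0).net = ∅
  received : ∀ t m, (act t).recv = some m → m ∈ (conf t).net
  step : ∀ t, Step S (actor t) ((conf t).status (actor t)) (act t)
    ((conf (t + 1)).status (actor t))
  frame : ∀ t b, b ≠ actor t → (conf (t + 1)).status b = (conf t).status b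
  net_step : ∀ t, (conf (t + 1)).net = (conf t).net ∪ (act t).sent

/-- In the configuration `c`, the primary of `v` runs as the primary in the view `v`. -/
def InForce {S : System} (c : Config S) (v : PrimaryView S) : Prop :=
  ∃ l, c.status v.primary = .running l ∧ l.phase = .primary ∧ l.view = some v

/-- The view `v` begins with step `t`. -/
def Execution.BeginsAt {S : System} (E : Execution S) (v : PrimaryView S) (t : ℕ) : Prop :=
  ¬ InForce (E.conf t) v ∧ InForce (E.conf (t + 1)) v

/-- An infinite sequence of consecutive primary views of the group `g`: views that come into
being in the execution, with consecutive view numbers, where the primary of each view after the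
first was in the preceding view until it began the new one. -/
structure ViewSequence {S : System} (E : Execution S) (g : S.Group) where
  view : ℕ → PrimaryView S
  /-- the step with which each view begins -/
  start : ℕ → ℕ
  group_eq : ∀ n, (view n).group = g
  begins : ∀ n, E.BeginsAt (view n) (start n)
  pvn_succ : ∀ n, (view (n + 1)).pvn = (view n).pvn + 1
  from_prev : ∀ n, ∃ l, (E.conf (start (n + 1))).status (view (n + 1)).primary = .running l ∧
    l.view = some (view n)

/-- The operations in the `n`th view of the sequence, given by the steps at which they take place:
those that the primary of the view performs as the primary in that view, before the next view of
the sequence begins. -/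
def ViewSequence.ops {S : System} {E : Execution S} {g : S.Group} (W : ViewSequence E g)
    (n : ℕ) : Set ℕ :=
  {t | W.start n ≤ t ∧ t < W.start (n + 1) ∧ E.actor t = (W.view n).primary ∧
    InForce (E.conf t) (W.view n) ∧ (E.act t).IsOperation}

/-- The infinite sequence `σ` is the sequence of operations in the sequence of views: the
concatenation, in the order of the views, of the sequences of operations in the single views.
`σ k = (n, t)` means that its `k`th operation is `E.act t`, in the `n`th view. -/
structure ViewSequence.IsOperationSequence {S : System} {E : Execution S} {g : S.Group}
    (W : ViewSequence E g) (σ : ℕ → ℕ × ℕ) : Prop where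
  mem : ∀ k, (σ k).2 ∈ W.ops (σ k).1
  ordered : ∀ j k, j < k →
    (σ j).1 < (σ k).1 ∨ ((σ j).1 = (σ k).1 ∧ (σ j).2 < (σ k).2)
  complete : ∀ n t, t ∈ W.ops n → ∃ k, σ k = (n, t)

end LLFT

/-! The heart of the matter is that every view of the sequence contains at least one operation. This
is not immediate, since the steps that begin a view (`becomeFirst`, `installView`) neither compute,
receive nor transmit. The reason is a flow of information: the primary of the next view was in the
present view without being its primary, because a primary never leaves its view except by stopping.
Such a replica must have learned of the view, from an `AcceptBackup` message or from the
`viewChange` entry that orders the start of the view. That information originates with the primary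
of the view alone, and it leaves that primary only by transmission, which is an operation.

The argument is an invariant, `Execution.unaware_of_not_operated`: as long as the primary of `v` has
performed no operation in `v`, no message in the network reveals `v` and every replica other than
that primary is `Local.Unaware` of `v`. To be inductive, `Local.Unaware` must cover every place from
which such information could later reach a view or a message, including the messages kept for
retransmission. A single step preserves it by `Step.sent_not_mentions` and `Step.unaware`; the
exempted primary is handled by `Step.primary_stable`.

Since a view is in force only from its beginning on (`Execution.BeginsAt.le`), the operation found
lies between the beginnings of two successive views. Hence the beginnings are strictly increasing,
the views occupy consecutive finite intervals of time, and concatenation in the order of view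
numbers agrees with the order of time. The steps at which operations occur form an infinite set of
naturals, and its increasing enumeration is the required sequence. -/

namespace LLFT

variable {S : System}

/-! ### Knowledge of a view -/

/-- `A` contains the entry that orders the start of the view `v`. -/
def Starts (A : Set (OrderInfo S)) (v : PrimaryView S) : Prop :=
  ∃ x ∈ A, x.kind = .viewChange ∧ x.view = v

/-- The messages through which a replica can learn of the view `v`. -/
def Msg.Mentions (v : PrimaryView S) : Msg S → Prop
  | .acceptBackup w _ _ => w = v
  | .state _ _ cp => Starts {x | x ∈ cp.log} v ∨ ∃ e, Starts (cp.remoteInfo e) v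
  | .newPrimaryView _ _ _ info => Starts {x | x ∈ info} v
  | .orderInfo _ info => Starts {x | x ∈ info} v
  | .app m => Starts {x | x ∈ m.so} v ∨ Starts {x | x ∈ m.ro} v
  | _ => False

/-- The local state neither refers to the view `v` nor holds the entry that orders its start. -/
structure Local.Unaware (l : Local S) (v : PrimaryView S) : Prop where
  view : l.view ≠ some v
  log : ¬ Starts {x | x ∈ l.log} v
  pool : ¬ Starts l.pool v
  remoteInfo : ∀ e, ¬ Starts (l.remoteInfo e) v
  pending : ∀ m ∈ l.pending, ¬ m.Mentions v
  sent : ∀ m ∈ l.sent, ¬ (Msg.app m).Mentions v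

/-! ### Single steps and the spread of knowledge -/

theorem membershipMsg_mentions {v w : PrimaryView S} {ms : List Member} {n : Option Member}
    (h : (membershipMsg w ms n).Mentions v) : w = v := by
  cases n <;> simp_all [membershipMsg, Msg.Mentions]

theorem Local.not_starts_addInfo_remoteInfo {l : Local S} {e : S.End} {m : AppMsg S}
    {v : PrimaryView S} (hl : ∀ e, ¬ Starts (l.remoteInfo e) v)
    (hm : ¬ (Msg.app m).Mentions v) (e' : S.End) :
    ¬ Starts ((l.addInfo e m).remoteInfo e') v := by
  have := hl e
  have := hl e'
  simp only [Local.addInfo, setAt]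
  split <;> grind [Starts, Msg.Mentions]

/-- All that a transmitted message can reveal comes from the sender's view, from ordering
information that it holds, from a message that it keeps for retransmission, or, in `outranked`, from
the message just received. The first three are covered by `Local.Unaware`, the last by `hr`. A newly
made `call` entry is harmless, as only `viewChange` entries count in `Starts`. -/
theorem Step.sent_not_mentions {b : BirthId} {l : Local S} {a : Action S} {s : Status S}
    {v : PrimaryView S} (h : Step S b (.running l) a s) (hl : l.Unaware v)
    (hr : ∀ m, a.recv = some m → ¬ m.Mentions v) : ∀ m ∈ a.sent, ¬ m.Mentions v := by
  obtain ⟨hview, hlog, hpool, hrem, hpend, hsent⟩ := hl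
  cases h
  case excludeSilent hv _ _ =>
    rintro m rfl hm
    exact hview (membershipMsg_mentions hm ▸ hv)
  case commit =>
    rintro m ⟨n, -, rfl⟩ (hm | ⟨e, hm⟩)
    exacts [hlog hm, hrem e hm]
  all_goals intro m hm
  all_goals try simp only [Set.mem_empty_iff_false, Set.mem_singleton_iff, Set.mem_ofPred_eq] at hm
  all_goals try subst hm
  all_goals first
    | (simp [Msg.Mentions]; done)
    | grind [Msg.Mentions, membershipMsg, Local.mkMsg, Local.entry, Starts]

/-- A replica enters a view by accepting an `AcceptBackup` message, by following a `viewChange`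
entry from its pool, or by creating the view with itself as primary. The first is excluded by `hr`,
the second by the unaware pool, the third by `hb`. Messages newly kept for retransmission are,
outside `followCall`, also transmitted in the same step, so `Step.sent_not_mentions` applies to
them. -/
theorem Step.unaware {b : BirthId} {l l' : Local S} {a : Action S}
    {v : PrimaryView S} (h : Step S b (.running l) a (.running l')) (hl : l.Unaware v)
    (hr : ∀ m, a.recv = some m → ¬ m.Mentions v)
    (hb : ¬ (l'.phase = .primary ∧ l'.view = some v ∧ v.primary = b)) : l'.Unaware v := by
  have hs := h.sent_not_mentions hl hr
  obtain ⟨hview, hlog, hpool, hrem, hpend, hsent⟩ := hl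
  cases h
  all_goals constructor
  all_goals try assumption
  -- A follower keeps the messages that it reproduces without transmitting them; they carry no
  -- ordering information.
  case followCall.sent hms =>
    rintro m (hm | hm)
    · exact hsent m hm
    · rw [hms] at hm
      obtain ⟨-, e, p, -, rfl⟩ := hm
      simp [Msg.Mentions, Local.mkMsg, Starts]
  case recvApp.remoteInfo => exact Local.not_starts_addInfo_remoteInfo hrem (hr _ rfl)
  case recvKeepAlive.remoteInfo => exact Local.not_starts_addInfo_remoteInfo hrem (hr _ rfl)
  all_goals grind [Msg.Mentions, membershipMsg, Local.afterCall, Local.afterDeliver,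
    Local.addInfo, Local.entry, Starts, setAt]

/-- A primary stays the primary of its view until it stops. -/
theorem Step.primary_stable {b : BirthId} {l : Local S} {a : Action S} {s : Status S}
    (h : Step S b (.running l) a s) (hl : l.phase = .primary) :
    s = .stopped ∨ ∃ l', s = .running l' ∧ l'.phase = .primary ∧ l'.view = l.view := by
  cases h <;> simp_all [Local.afterCall, Local.afterDeliver, Local.addInfo]

theorem Step.of_notStarted {b : BirthId} {a : Action S} {s : Status S}
    (h : Step S b .notStarted a s) :
    ∃ g, a = ⟨none, none, {.proposeBackup g b}⟩ ∧ s = .running (Local.fresh g b) := by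
  cases h; exact ⟨_, rfl, rfl⟩

theorem not_step_stopped {b : BirthId} {a : Action S} {s : Status S} :
    ¬ Step S b .stopped a s := by
  intro h; cases h

theorem Local.fresh_unaware (g : S.Group) (b : BirthId) (v : PrimaryView S) :
    (Local.fresh g b).Unaware v := by
  constructor <;> simp [Local.fresh, Starts, Msg.Mentions]

/-! ### Invariants of executions -/

namespace Execution

variable (E : Execution S)

/-- Before step `t`, the primary of `v` has performed an operation as the primary in `v`. -/
def Operated (v : PrimaryView S) (t : ℕ) : Prop :=
  ∃ s < t, E.actor s = v.primary ∧ InForce (E.conf s) v ∧ (E.act s).IsOperation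

variable {E}

/-- Nobody but its primary knows of a view in which the primary has performed no operation. -/
theorem unaware_of_not_operated {v : PrimaryView S} (t : ℕ) (hv : ¬ E.Operated v t) :
    (∀ m ∈ (E.conf t).net, ¬ m.Mentions v) ∧
      ∀ b l, (E.conf t).status b = .running l →
        ¬ (l.phase = .primary ∧ l.view = some v ∧ v.primary = b) → l.Unaware v := by
  induction t with
  | zero => simp [E.init_net, E.init_status]
  | succ t ih =>
    obtain ⟨hnet, hloc⟩ := ih fun ⟨s, hs, h⟩ => hv ⟨s, by omega, h⟩
    have hrecv : ∀ m, (E.act t).recv = some m → ¬ m.Mentions v :=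
      fun m hm => hnet m (E.received t m hm)
    have hstep := E.step t
    -- Only the actor changes its status and only its messages enter the network.
    suffices h : (∀ m ∈ (E.act t).sent, ¬ m.Mentions v) ∧
        ∀ l, (E.conf (t + 1)).status (E.actor t) = .running l →
          ¬ (l.phase = .primary ∧ l.view = some v ∧ v.primary = E.actor t) → l.Unaware v by
      refine ⟨fun m hm => ?_, fun b l hl => ?_⟩
      · rw [E.net_step] at hm
        exact hm.elim (hnet m) (h.1 m)
      · by_cases hb : b = E.actor t
        · subst hb
          exact h.2 l hl
        · exact hloc b l (E.frame t b hb ▸ hl)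
    cases hst : (E.conf t).status (E.actor t) with
    | notStarted =>
      obtain ⟨g, ha, hs⟩ := Step.of_notStarted (hst ▸ hstep)
      rw [ha, hs]
      refine ⟨by simp [Msg.Mentions], fun l hl _ => ?_⟩
      cases hl
      exact Local.fresh_unaware _ _ _
    | stopped => exact (not_step_stopped (hst ▸ hstep)).elim
    | running l =>
      rw [hst] at hstep
      -- If the actor is the exempted primary, its step is no operation, so it transmits nothing,
      -- and it remains exempted or stops. Any other actor is unaware of `v`, and so is the network
      -- from which it receives.
      by_cases hp : l.phase = .primary ∧ l.view = some v ∧ v.primary = E.actor t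
      · obtain ⟨hph, hlv, hb⟩ := hp
        have hop : ¬ (E.act t).IsOperation := fun h =>
          hv ⟨t, t.lt_succ_self, hb.symm, ⟨l, hb ▸ hst, hph, hlv⟩, h⟩
        refine ⟨fun m hm => (hop (.inr (.inr ⟨m, hm⟩))).elim, fun l' hl' hl'p => ?_⟩
        obtain h | ⟨l'', h, h1, h2⟩ := hstep.primary_stable hph
        · simp [h] at hl'
        · rw [h] at hl'
          cases hl'
          exact (hl'p ⟨h1, h2.trans hlv, hb⟩).elim
      · have hu := hloc _ l hst hp
        refine ⟨hstep.sent_not_mentions hu hrecv, fun l' hl' hl'p => ?_⟩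
        rw [hl'] at hstep
        exact hstep.unaware hu hrecv hl'p

theorem status_stopped_mono {b : BirthId} {s t : ℕ} (hst : s ≤ t)
    (h : (E.conf s).status b = .stopped) : (E.conf t).status b = .stopped := by
  induction t, hst using Nat.le_induction with
  | base => exact h
  | succ t _ ih =>
    by_cases hb : b = E.actor t
    · subst hb
      exact (not_step_stopped (ih ▸ E.step t)).elim
    · rw [E.frame t b hb, ih]

/-- Iterates `Step.primary_stable`; a stopped replica never runs again under the same identity. -/
theorem inForce_or_stopped {v : PrimaryView S} {s t : ℕ} (hst : s ≤ t)
    (h : InForce (E.conf s) v) :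
    InForce (E.conf t) v ∨ (E.conf t).status v.primary = .stopped := by
  induction t, hst using Nat.le_induction with
  | base => exact .inl h
  | succ t _ ih =>
    obtain ⟨l, hl, hph, hlv⟩ | ih := ih
    · by_cases hb : v.primary = E.actor t
      · have hstep := E.step t
        rw [← hb, hl] at hstep
        obtain h | ⟨l', h, h1, h2⟩ := hstep.primary_stable hph
        · exact .inr h
        · exact .inl ⟨l', h, h1, h2.trans hlv⟩
      · exact .inl ⟨l, by rw [E.frame t _ hb, hl], hph, hlv⟩
    · exact .inr (status_stopped_mono t.le_succ ih)

/-- A view is not in force before it begins. -/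
theorem BeginsAt.le {v : PrimaryView S} {s t : ℕ} (hv : E.BeginsAt v t)
    (h : InForce (E.conf s) v) : t ≤ s := by
  by_contra! hst
  -- A view in force before `t` but not at `t` has a stopped primary, which could not be running at
  -- `t + 1`.
  have h1 := (inForce_or_stopped hst.le h).resolve_left hv.1
  obtain ⟨l, hl, -⟩ := hv.2
  rw [status_stopped_mono t.le_succ h1] at hl
  cases hl

end Execution

/-! ### Operations in a sequence of views -/

namespace ViewSequence

variable {E : Execution S} {g : S.Group} (W : ViewSequence E g)

/-- The primary of each view performs an operation in it before the next view begins. -/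
theorem ops_nonempty (n : ℕ) : (W.ops n).Nonempty := by
  obtain ⟨l, hl, hlv⟩ := W.from_prev n
  -- A replica that is already a primary keeps its view through the step, so it could not be in view
  -- `n + 1`, with a different view number, right after it.
  have hnp : l.phase ≠ .primary := by
    intro hph
    obtain ⟨l', hl', hph', hlv'⟩ := (W.begins (n + 1)).2
    have hne : W.view n ≠ W.view (n + 1) := fun h => by
      have := W.pvn_succ n
      rw [← h] at this
      omega
    by_cases hb : (W.view (n + 1)).primary = E.actor (W.start (n + 1))
    · have hstep := E.step (W.start (n + 1))
      rw [← hb, hl, hl'] at hstep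
      obtain h | ⟨l'', h, -, h2⟩ := hstep.primary_stable hph
      · cases h
      · cases h
        rw [hlv', hlv] at h2
        exact hne (Option.some.inj h2).symm
    · rw [E.frame _ _ hb, hl] at hl'
      cases hl'
      exact hne (Option.some.inj (hlv.symm.trans hlv'))
  -- Otherwise the invariant makes this replica, which is not in the primary phase, unaware of the
  -- view that it is in.
  have hop : E.Operated (W.view n) (W.start (n + 1)) := by
    by_contra h
    exact ((E.unaware_of_not_operated _ h).2 _ l hl fun h => hnp h.1).view hlv
  obtain ⟨t, ht, ha, hf, ho⟩ := hop
  exact ⟨t, (W.begins n).le hf, ht, ha, hf, ho⟩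

theorem start_strictMono : StrictMono W.start :=
  strictMono_nat_of_lt_succ fun n =>
    let ⟨_, h⟩ := W.ops_nonempty n; h.1.trans_lt h.2.1

/-- The operations of view `n` lie in the half-open interval from `W.start n` to `W.start (n + 1)`,
and these intervals follow one another. Used with `s = t` in both directions, this also shows that a
step belongs to at most one view. -/
theorem le_of_mem_ops {m n s t : ℕ} (hs : s ∈ W.ops m) (ht : t ∈ W.ops n) (h : s ≤ t) :
    m ≤ n := by
  by_contra! hnm
  have : W.start (n + 1) ≤ W.start m := W.start_strictMono.monotone hnm
  have := hs.1
  have := ht.2.1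
  omega

theorem infinite_iUnion_ops : {t | ∃ n, t ∈ W.ops n}.Infinite := by
  refine Set.infinite_of_not_bddAbove fun ⟨B, hB⟩ => ?_
  -- View `B + 1` begins no earlier than step `B + 1`, by strict monotonicity, so its operations
  -- exceed the supposed bound `B`.
  obtain ⟨t, ht⟩ := W.ops_nonempty (B + 1)
  have h1 : t ≤ B := hB ⟨_, ht⟩
  have h2 := W.start_strictMono.le_apply (x := B + 1)
  have h3 := ht.1
  omega

end ViewSequence

end LLFT

/-! ### Enumeration of the operations -/

theorem theorem6 (S : LLFT.System) (E : LLFT.Execution S) (g : S.Group)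
    (W : LLFT.ViewSequence E g) :
    ∃ σ : ℕ → ℕ × ℕ, W.IsOperationSequence σ := by
  have hinf := W.infinite_iUnion_ops
  -- `Nat.nth` lists the operation steps in increasing order; `n k` is a view to which the `k`th of
  -- them belongs.
  choose n hn using fun k => Nat.nth_mem_of_infinite (p := fun t => ∃ n, t ∈ W.ops n) hinf k
  refine ⟨fun k => (n k, Nat.nth (fun t => ∃ n, t ∈ W.ops n) k), hn, fun j k hjk => ?_,
    fun m t ht => ?_⟩
  · have hlt := Nat.nth_strictMono (p := fun t => ∃ n, t ∈ W.ops n) hinf hjk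
    exact (W.le_of_mem_ops (hn j) (hn k) hlt.le).lt_or_eq.imp_right fun h => ⟨h, hlt⟩
  · have ⟨k, hk⟩ : t ∈ Set.range (Nat.nth fun t => ∃ n, t ∈ W.ops n) := by
      rw [Nat.range_nth_of_infinite hinf]
      exact ⟨m, ht⟩
    have h := hn k
    rw [hk] at h
    -- The chosen index is the given `m`, since the intervals of distinct views are disjoint.
    exact ⟨k, Prod.ext (le_antisymm (W.le_of_mem_ops h ht le_rfl)
      (W.le_of_mem_ops ht h le_rfl)) hk⟩
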